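/- For a bounded measurable set $A\subset\mathbb{R}^d$ let $\hat 1_A(\xi)=\int_A e^{-2\pi i\langle x,\xi\rangle}\,dx$. A convex body is a compact convex set with nonempty interior; it is centrally symmetric if $A=-A$. A set $A\subset\mathbb{R}^d$ is a multi-tiler if there are an integer $k\ge 1$ and a set $\Lambda\subset\mathbb{R}^d$ such that almost every point of $\mathbb{R}^d$ lies in exactly $k$ of the translates $A+\lambda$, $\lambda\in\Lambda$. Robins' conjecture in dimension $d$ asserts: for all centrally symmetric convex bodies $P,Q\subset\mathbb{R}^d$ that are not multi-tilers, $\hat 1_P(\xi)=\hat 1_Q(\xi)$ for all $\xi\in\mathbb{Z}^d$ if and only if $P$ and $Q$ coincide up to a rigid motion (an isometry of $\mathbb{R}^d$), except on a set of measure zero. Theorem. Robins' conjecture is false in every dimension $d\ge 4$. More precisely, let $d\ge 4$, let $R\subset\mathbb{R}^2$ be the rhombus with vertices $(\pm1,0),(0,\pm3)$, let $H\subset\mathbb{R}^2$ be the hexagon with vertices $(\pm1,\pm1),(0,\pm2)$ (both including their interiors), let $B\subset\mathbb{R}^{d-2}$ be the closed unit ball centered at the origin, and put $P=R\times B$ and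 $Q=H\times B$. Then $P$ and $Q$ are centrally symmetric convex bodies in $\mathbb{R}^d$, neither is a polytope, neither is a multi-tiler, $\hat 1_P(\xi)=\hat 1_Q(\xi)$ for all $\xi\in\mathbb{Z}^d$, and yet $P$ and $Q$ do not coincide up to a rigid motion, even up to a set of measure zero. -/

import Mathlib

open MeasureTheory
open scoped FourierTransform

noncomputable section

/-- A convex body: a compact convex set with nonempty interior. -/
def IsConvexBody {d : ℕ} (A : Set (EuclideanSpace ℝ (Fin d))) : Prop :=
  Convex ℝ A ∧ IsCompact A ∧ (interior A).Nonempty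

/-- Central symmetry about the origin. -/
def IsCentrallySymmetric {d : ℕ} (A : Set (EuclideanSpace ℝ (Fin d))) : Prop :=
  ∀ x ∈ A, -x ∈ A

/-- A (bounded) polytope: the convex hull of finitely many points. -/
def IsPolytope {d : ℕ} (A : Set (EuclideanSpace ℝ (Fin d))) : Prop :=
  ∃ S : Set (EuclideanSpace ℝ (Fin d)), S.Finite ∧ A = convexHull ℝ S

/-- `A` `k`-tiles the space with translation set `L`: almost every point `x` lies in exactly `k`
of the translates `A + l`, `l ∈ L`. -/
def KTiles {d : ℕ} (A : Set (EuclideanSpace ℝ (Fin d))) (k : ℕ)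
    (L : Set (EuclideanSpace ℝ (Fin d))) : Prop :=
  ∀ᵐ x ∂(volume : Measure (EuclideanSpace ℝ (Fin d))), {l ∈ L | x - l ∈ A}.encard = (k : ℕ∞)

/-- A multi-tiler: a set that `k`-tiles with some translation set, for some `k ≥ 1`. -/
def IsMultiTiler {d : ℕ} (A : Set (EuclideanSpace ℝ (Fin d))) : Prop :=
  ∃ k : ℕ, 1 ≤ k ∧ ∃ L : Set (EuclideanSpace ℝ (Fin d)), KTiles A k L

/-- The Fourier transform `ξ ↦ ∫ x in A, exp (-2 π i ⟨x, ξ⟩)` of the indicator function of `A`. -/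
def indicatorFourier {d : ℕ} (A : Set (EuclideanSpace ℝ (Fin d))) :
    EuclideanSpace ℝ (Fin d) → ℂ :=
  𝓕 (A.indicator (fun _ => (1 : ℂ)))

/-- The Fourier transforms of the indicators of `A` and `B` agree on the lattice `ℤ ^ d`. -/
def FourierAgreeOnLattice {d : ℕ} (A B : Set (EuclideanSpace ℝ (Fin d))) : Prop :=
  ∀ m : Fin d → ℤ, indicatorFourier A (WithLp.toLp 2 (fun i => (m i : ℝ))) =
    indicatorFourier B (WithLp.toLp 2 (fun i => (m i : ℝ)))

/-- `A` and `B` coincide up to a rigid motion (a Euclidean isometry of the space) and up to a set of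
Lebesgue measure zero. -/
def CoincideUpToRigidMotion {d : ℕ} (A B : Set (EuclideanSpace ℝ (Fin d))) : Prop :=
  ∃ g : EuclideanSpace ℝ (Fin d) ≃ᵃⁱ[ℝ] EuclideanSpace ℝ (Fin d),
    g '' A =ᵐ[(volume : Measure (EuclideanSpace ℝ (Fin d)))] B

/-- Robins' conjecture in dimension `d`. -/
def RobinsConjecture (d : ℕ) : Prop :=
  ∀ P Q : Set (EuclideanSpace ℝ (Fin d)),
    IsConvexBody P → IsConvexBody Q → IsCentrallySymmetric P → IsCentrallySymmetric Q →
    ¬ IsMultiTiler P → ¬ IsMultiTiler Q →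
    (FourierAgreeOnLattice P Q ↔ CoincideUpToRigidMotion P Q)

/-- The (filled) rhombus with vertices `(±1, 0)`, `(0, ±3)`. -/
def rhombus : Set (EuclideanSpace ℝ (Fin 2)) :=
  convexHull ℝ {!₂[-1, 0], !₂[0, 3], !₂[1, 0], !₂[0, -3]}

/-- The (filled) hexagon with vertices `(±1, ±1)`, `(0, ±2)`. -/
def hexagon : Set (EuclideanSpace ℝ (Fin 2)) :=
  convexHull ℝ {!₂[-1, 1], !₂[0, 2], !₂[1, 1], !₂[1, -1], !₂[0, -2], !₂[-1, -1]}

/-- The Cartesian product of `A ⊆ ℝ ^ m` and `B ⊆ ℝ ^ n` as a subset of `ℝ ^ (m + n)`. -/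
def euclideanProd {m n : ℕ} (A : Set (EuclideanSpace ℝ (Fin m)))
    (B : Set (EuclideanSpace ℝ (Fin n))) : Set (EuclideanSpace ℝ (Fin (m + n))) :=
  {x | WithLp.toLp 2 (fun i : Fin m => x (Fin.castAdd n i)) ∈ A ∧
       WithLp.toLp 2 (fun j : Fin n => x (Fin.natAdd m j)) ∈ B}

/-- The product of a planar set with the closed unit ball of `ℝ ^ n`. -/
def timesBall (K : Set (EuclideanSpace ℝ (Fin 2))) (n : ℕ) :
    Set (EuclideanSpace ℝ (Fin (2 + n))) :=
  euclideanProd K (Metric.closedBall (0 : EuclideanSpace ℝ (Fin n)) 1)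

/-- `P` and `Q` satisfy the hypotheses of Robins' conjecture, their transforms agree on the lattice,
and yet they do not coincide up to rigid motion. -/
def IsRobinsCounterexample {d : ℕ} (P Q : Set (EuclideanSpace ℝ (Fin d))) : Prop :=
  (IsConvexBody P ∧ IsConvexBody Q) ∧ (IsCentrallySymmetric P ∧ IsCentrallySymmetric Q) ∧
  (¬ IsMultiTiler P ∧ ¬ IsMultiTiler Q) ∧
  FourierAgreeOnLattice P Q ∧ ¬ CoincideUpToRigidMotion P Q

end

open Set Filter Topology

/-! ### Products of Euclidean spaces -/

/-! Rhombus and hexagon are the members `(a, b) = (0, 3)` and `(1, 2)` of one family, `kite a b`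
with `a + b = 3`. The vertical sections over `x` and `x - 1`, for `0 ≤ x ≤ 1`, have half-heights
adding up to `a + b = 3`. Modulo integers, two such segments glue to a segment of length 6, so at
integer frequencies the transform depends only on `a + b` (`integral_kite`). Transforms of products
factor, so the agreement survives multiplication by a ball.

The ball factor rules out multi-tiling: by Fubini, a multi-tiling by `A × B` would give a family of
unit balls, counted with multiplicity, covering almost every point of `ℝ ^ n` exactly `k` times. For
`n ≥ 2` some point of one bounding sphere avoids all the other spheres, and the count jumps there
(`not_ae_encard_closedBall_eq`). The roundness of the ball also prevents the products from being
polytopes.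

Congruence fails by diameter: the rhombus product contains two points at distance 6, while the
hexagon product lies in the ball of radius `√5`. -/

theorem finAddEquivProd_apply {m n : ℕ} (x : EuclideanSpace ℝ (Fin (m + n))) :
    EuclideanSpace.finAddEquivProd x =
      (WithLp.toLp 2 (fun i : Fin m => x (Fin.castAdd n i)),
        WithLp.toLp 2 (fun j : Fin n => x (Fin.natAdd m j))) := by
  apply Prod.ext <;> ext i <;> simp

theorem volume_preserving_finAddEquivProd {m n : ℕ} :
    MeasurePreserving (EuclideanSpace.finAddEquivProd (𝕜 := ℝ) (n := m) (m := n)) :=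
  (WithLp.volume_preserving_ofLp _ _).comp
    ((LinearIsometryEquiv.measurePreserving (PiLp.sumPiLpEquivProdLpPiLp 2 (fun _ ↦ ℝ))).comp
      (LinearIsometryEquiv.measurePreserving
        (LinearIsometryEquiv.piLpCongrLeft 2 ℝ ℝ finSumFinEquiv.symm)))

theorem euclideanProd_eq_preimage {m n : ℕ} (A : Set (EuclideanSpace ℝ (Fin m)))
    (B : Set (EuclideanSpace ℝ (Fin n))) :
    euclideanProd A B = EuclideanSpace.finAddEquivProd ⁻¹' (A ×ˢ B) := by
  ext x
  simp only [mem_preimage, finAddEquivProd_apply, mem_prod]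
  rfl

theorem isConvexBody_euclideanProd {m n : ℕ} {A : Set (EuclideanSpace ℝ (Fin m))}
    {B : Set (EuclideanSpace ℝ (Fin n))} (hA : IsConvexBody A) (hB : IsConvexBody B) :
    IsConvexBody (euclideanProd A B) := by
  rw [euclideanProd_eq_preimage]
  set e := EuclideanSpace.finAddEquivProd (𝕜 := ℝ) (n := m) (m := n)
  refine ⟨(hA.1.prod hB.1).linear_preimage e.toLinearEquiv.toLinearMap, ?_, ?_⟩
  · exact e.toHomeomorph.isCompact_preimage.2 (hA.2.1.prod hB.2.1)
  · have h : interior (e ⁻¹' (A ×ˢ B)) = e ⁻¹' interior (A ×ˢ B) :=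
      (e.toHomeomorph.preimage_interior _).symm
    rw [h, interior_prod_eq]
    exact (hA.2.2.prod hB.2.2).preimage e.surjective

theorem isCentrallySymmetric_euclideanProd {m n : ℕ} {A : Set (EuclideanSpace ℝ (Fin m))}
    {B : Set (EuclideanSpace ℝ (Fin n))} (hA : IsCentrallySymmetric A)
    (hB : IsCentrallySymmetric B) : IsCentrallySymmetric (euclideanProd A B) :=
  fun _ hx => ⟨hA _ hx.1, hB _ hx.2⟩

theorem isConvexBody_closedBall (n : ℕ) :
    IsConvexBody (Metric.closedBall (0 : EuclideanSpace ℝ (Fin n)) 1) :=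
  ⟨convex_closedBall _ _, isCompact_closedBall _ _,
    ⟨0, Metric.ball_subset_interior_closedBall (Metric.mem_ball_self one_pos)⟩⟩

theorem isCentrallySymmetric_closedBall (n : ℕ) :
    IsCentrallySymmetric (Metric.closedBall (0 : EuclideanSpace ℝ (Fin n)) 1) := by
  intro x hx
  simpa using hx

/-! ### Spheres avoiding finitely many other spheres -/

section Sphere

variable {E : Type*} [NormedAddCommGroup E] [InnerProductSpace ℝ E]

/-- A rational parametrization of the unit circle spanned by `u` and `v`. -/
noncomputable def circleParam (u v : E) (t : ℝ) : E := (1 + t ^ 2)⁻¹ • ((1 - t ^ 2) • u + (2 * t) • v)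

theorem norm_circleParam {u v : E} (hu : ‖u‖ = 1) (hv : ‖v‖ = 1) (huv : inner ℝ u v = 0) (t : ℝ) :
    ‖circleParam u v t‖ = 1 := by
  have ht : (0 : ℝ) < 1 + t ^ 2 := by positivity
  have h : ‖(1 - t ^ 2) • u + (2 * t) • v‖ ^ 2 = (1 + t ^ 2) ^ 2 := by
    rw [norm_add_sq_real, norm_smul, norm_smul, inner_smul_left, inner_smul_right, huv, hu, hv]
    simp only [Real.norm_eq_abs, mul_one, sq_abs, mul_zero, add_zero]
    ring
  have h' := (sq_eq_sq₀ (norm_nonneg _) ht.le).1 h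
  rw [circleParam, norm_smul, h', Real.norm_eq_abs, abs_of_pos (inv_pos.2 ht),
    inv_mul_cancel₀ ht.ne']

/-- Clearing denominators gives a polynomial in `t` of degree at most 2. Its constant and quadratic
coefficients add up to `-2c`, so it is nonzero. -/
theorem finite_inner_circleParam_eq (u v w : E) {c : ℝ} (hc : c ≠ 0) :
    {t : ℝ | inner ℝ (circleParam u v t) w = c}.Finite := by
  let p : Polynomial ℝ := Polynomial.C (-(inner ℝ u w) - c) * Polynomial.X ^ 2 +
    Polynomial.C (2 * inner ℝ v w) * Polynomial.X + Polynomial.C (inner ℝ u w - c)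
  have hp : p ≠ 0 := by
    intro h
    have h0 := congrArg (Polynomial.coeff · 0) h
    have h2 := congrArg (Polynomial.coeff · 2) h
    simp only [p, Polynomial.coeff_add, Polynomial.coeff_C_mul, Polynomial.coeff_X_pow,
      Polynomial.coeff_X, Polynomial.coeff_C, Polynomial.coeff_zero] at h0 h2
    norm_num at h0 h2
    apply hc
    linarith
  refine (Polynomial.finite_setOfPred_isRoot hp).subset fun t ht => ?_
  have ht' : (1 + t ^ 2 : ℝ) ≠ 0 := by positivity
  simp only [circleParam, mem_ofPred_eq, inner_smul_left, inner_add_left] at ht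
  simp only [map_inv₀, conj_trivial] at ht
  rw [inv_mul_eq_iff_eq_mul₀ ht'] at ht
  simp only [mem_ofPred_eq, Polynomial.IsRoot, p]
  simp
  linarith

/-- For a unit vector `x`, the point `a + x` lies on the unit sphere about `c` iff `⟪x, c - a⟫ = ‖c
- a‖ ^ 2 / 2`, which is nonzero when `c ≠ a`. Each `c` thus excludes only finitely many parameters
on a circle about `a`. -/
theorem exists_mem_sphere_forall_notMem_sphere {u v : E} (hu : ‖u‖ = 1) (hv : ‖v‖ = 1)
    (huv : inner ℝ u v = 0) (a : E) {S : Set E} (hS : S.Finite) (haS : a ∉ S) :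
    ∃ p ∈ Metric.sphere a 1, ∀ c ∈ S, p ∉ Metric.sphere c 1 := by
  have hfin : (⋃ c ∈ S, {t : ℝ | inner ℝ (circleParam u v t) (c - a) = ‖c - a‖ ^ 2 / 2}).Finite := by
    refine hS.biUnion fun c hc => finite_inner_circleParam_eq u v _ ?_
    have : c - a ≠ 0 := sub_ne_zero.2 fun h => haS (h ▸ hc)
    positivity
  obtain ⟨t, ht⟩ := hfin.exists_notMem
  refine ⟨a + circleParam u v t, by simp [norm_circleParam hu hv huv], fun c hc hp => ht ?_⟩
  refine mem_biUnion hc ?_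
  rw [mem_sphere_iff_norm, show a + circleParam u v t - c = circleParam u v t - (c - a) by abel] at hp
  have h := norm_sub_sq_real (circleParam u v t) (c - a)
  rw [hp, norm_circleParam hu hv huv] at h
  simp only [mem_ofPred_eq]
  linarith

end Sphere

theorem exists_orthonormal_pair {n : ℕ} (hn : 2 ≤ n) : ∃ u v : EuclideanSpace ℝ (Fin n),
    ‖u‖ = 1 ∧ ‖v‖ = 1 ∧ inner ℝ u v = 0 :=
  ⟨EuclideanSpace.single ⟨0, by omega⟩ 1, EuclideanSpace.single ⟨1, by omega⟩ 1,
    by simp, by simp, by simp [EuclideanSpace.inner_single_left]⟩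

/-! ### Unit balls do not cover the space exactly `k` times -/

/-- A unit ball centered in a ball of radius `1 / 2` contains that whole small ball, so a generic
point of it bounds the number of such centers by `k`. -/
theorem finite_centers_of_ae_encard_eq {E ι : Type*} [NormedAddCommGroup E] [MeasurableSpace E]
    [ProperSpace E] (μ : Measure E) [μ.IsOpenPosMeasure] {k : ℕ} {c : ι → E}
    (h : ∀ᵐ z ∂μ, {i | z ∈ Metric.closedBall (c i) 1}.encard = k) {K : Set E} (hK : IsCompact K) :
    {i | c i ∈ K}.Finite := by
  obtain ⟨T, -, hT, hKT⟩ := hK.elim_finite_subcover_image (b := univ)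
    (c := fun a : E => Metric.ball a (1 / 2)) (fun _ _ => Metric.isOpen_ball)
    (fun x _ => mem_biUnion (mem_univ x) (Metric.mem_ball_self (by norm_num)))
  have hsub : {i | c i ∈ K} ⊆ ⋃ a ∈ T, {i | c i ∈ Metric.ball a (1 / 2)} := by
    intro i hi
    obtain ⟨a, ha, hia⟩ := mem_iUnion₂.1 (hKT hi)
    exact mem_biUnion ha hia
  refine (hT.biUnion fun a _ => ?_).subset hsub
  have hpos : (μ (Metric.ball a (1 / 2))) ≠ 0 :=
    (Metric.isOpen_ball.measure_pos μ ⟨a, Metric.mem_ball_self (by norm_num)⟩).ne'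
  obtain ⟨z, hz, hzk⟩ := (frequently_ae_mem_iff.2 hpos).and_eventually h |>.exists
  refine (Set.finite_of_encard_eq_coe hzk).subset fun i hi => ?_
  have h1 : dist z a < 1 / 2 := hz
  have h2 : dist (c i) a < 1 / 2 := hi
  have := dist_triangle_right z (c i) a
  simp only [mem_ofPred_eq, Metric.mem_closedBall]
  linarith

/-- Crossing the sphere about `a` outwards at a point on no other sphere loses every ball centered
at `a` and gains none. The centers form an indexed family because they may repeat. -/
theorem not_ae_encard_closedBall_eq {n : ℕ} (hn : 2 ≤ n) {ι : Type*} {k : ℕ} (hk : 1 ≤ k)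
    (c : ι → EuclideanSpace ℝ (Fin n)) :
    ¬ ∀ᵐ z, {i | z ∈ Metric.closedBall (c i) 1}.encard = k := by
  intro h
  obtain ⟨z₀, hz₀⟩ := h.exists
  have hne : {i | z₀ ∈ Metric.closedBall (c i) 1}.Nonempty := by
    rw [nonempty_iff_ne_empty]
    intro h0
    rw [h0, encard_empty] at hz₀
    have : k = 0 := by exact_mod_cast hz₀.symm
    omega
  obtain ⟨i₀, -⟩ := hne
  set a := c i₀
  have hJ := finite_centers_of_ae_encard_eq volume h (isCompact_closedBall a 3)
  obtain ⟨u, v, hu, hv, huv⟩ := exists_orthonormal_pair hn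
  obtain ⟨p, hpa, hp⟩ := exists_mem_sphere_forall_notMem_sphere hu hv huv a
    (S := (c '' {i | c i ∈ Metric.closedBall a 3}) \ {a}) ((hJ.image c).sdiff) (by simp)
  have hpa' : dist p a = 1 := hpa
  have hev : ∀ᶠ z in 𝓝 p, ∀ i, c i ≠ a →
      (z ∈ Metric.closedBall (c i) 1 ↔ p ∈ Metric.closedBall (c i) 1) := by
    have h1 : ∀ᶠ z in 𝓝 p, ∀ i ∈ {i | c i ∈ Metric.closedBall a 3}, c i ≠ a →
        (z ∈ Metric.closedBall (c i) 1 ↔ p ∈ Metric.closedBall (c i) 1) := by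
      refine (eventually_all_finite hJ).2 fun i hi => ?_
      by_cases hia : c i = a
      · exact .of_forall fun z hz => (hz hia).elim
      have hpi : dist p (c i) ≠ 1 := hp _ ⟨⟨i, hi, rfl⟩, hia⟩
      have hc : ContinuousAt (fun z => dist z (c i)) p := by fun_prop
      rcases lt_or_gt_of_ne hpi with hlt | hgt
      · filter_upwards [hc.eventually_lt_const hlt] with z hz _
        exact iff_of_true hz.le hlt.le
      · filter_upwards [hc.eventually_const_lt hgt] with z hz _
        exact iff_of_false (not_le.2 hz) (not_le.2 hgt)
    -- A center farther than 3 from `a` is farther than 2 from `p`, hence farther than 1 from every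
    -- `z` in the unit ball about `p`.
    filter_upwards [h1, Metric.ball_mem_nhds p one_pos] with z hz hzp i hia
    by_cases hi : dist (c i) a ≤ 3
    · exact hz i hi hia
    · have hzp' : dist z p < 1 := hzp
      have t1 := dist_triangle_left (c i) a p
      have t2 := dist_triangle_left p (c i) z
      push Not at hi
      simp only [Metric.mem_closedBall]
      rw [← not_iff_not, not_le, not_le]
      exact iff_of_true (by linarith) (by linarith)
  obtain ⟨U, hU, hUo, hpU⟩ := eventually_nhds_iff.1 hev
  -- Points with the right count are dense, so one exists near `p` on each side of the sphere.
  have key : ∀ s : ℝ, a + s • (p - a) ∈ U → ∀ V : Set (EuclideanSpace ℝ (Fin n)), IsOpen V →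
      a + s • (p - a) ∈ V → ∃ z ∈ U ∩ V, {i | z ∈ Metric.closedBall (c i) 1}.encard = k := by
    intro s hsU V hV hsV
    have hpos := ((hUo.inter hV).measure_pos volume ⟨_, hsU, hsV⟩).ne'
    obtain ⟨z, hz, hzk⟩ := (frequently_ae_mem_iff.2 hpos).and_eventually h |>.exists
    exact ⟨z, hz, hzk⟩
  have hcont : ContinuousAt (fun s : ℝ => a + s • (p - a)) 1 := by fun_prop
  have hU1 : ∀ᶠ s : ℝ in 𝓝 1, a + s • (p - a) ∈ U :=
    hcont.eventually_mem (by simpa using hUo.mem_nhds hpU)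
  have hdist : ∀ s : ℝ, 0 < s → dist (a + s • (p - a)) a = s := by
    intro s hs
    rw [dist_eq_norm, add_sub_cancel_left, norm_smul, ← dist_eq_norm, hpa', mul_one,
      Real.norm_of_nonneg hs.le]
  obtain ⟨s, ⟨hsU, hs1⟩, hs0⟩ := ((hU1.filter_mono nhdsWithin_le_nhds).and
    (self_mem_nhdsWithin : Iio (1 : ℝ) ∈ 𝓝[<] 1)).and
    ((lt_mem_nhds one_pos).filter_mono nhdsWithin_le_nhds : ∀ᶠ s : ℝ in 𝓝[<] 1, 0 < s) |>.exists
  obtain ⟨r, hrU, hr1⟩ := ((hU1.filter_mono nhdsWithin_le_nhds).and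
    (self_mem_nhdsWithin : Ioi (1 : ℝ) ∈ 𝓝[>] 1)).exists
  obtain ⟨x, ⟨hxU, hxa⟩, hx⟩ := key s hsU (Metric.ball a 1) Metric.isOpen_ball
    (by rw [Metric.mem_ball, hdist s hs0]; exact hs1)
  obtain ⟨y, ⟨hyU, hya⟩, hy⟩ := key r hrU (Metric.closedBall a 1)ᶜ
    Metric.isClosed_closedBall.isOpen_compl (by
      rw [mem_compl_iff, Metric.mem_closedBall, hdist r (one_pos.trans hr1)]; exact not_le.2 hr1)
  have hss : {i | y ∈ Metric.closedBall (c i) 1} ⊂ {i | x ∈ Metric.closedBall (c i) 1} := by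
    refine (ssubset_iff_of_subset fun i hi => ?_).2
      ⟨i₀, Metric.ball_subset_closedBall hxa, hya⟩
    by_cases hia : c i = a
    · exact (hya (hia ▸ hi)).elim
    · exact (hU x hxU i hia).2 ((hU y hyU i hia).1 hi)
  have := (Set.finite_of_encard_eq_coe hy).encard_lt_encard hss
  rw [hx, hy] at this
  exact this.false

theorem not_isMultiTiler_euclideanProd_closedBall {m n : ℕ} (hn : 2 ≤ n)
    (A : Set (EuclideanSpace ℝ (Fin m))) :
    ¬ IsMultiTiler (euclideanProd A (Metric.closedBall (0 : EuclideanSpace ℝ (Fin n)) 1)) := by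
  rintro ⟨k, hk, L, hL⟩
  set e := EuclideanSpace.finAddEquivProd (𝕜 := ℝ) (n := m) (m := n) with he
  have h1 : ∀ᵐ q : EuclideanSpace ℝ (Fin m) × EuclideanSpace ℝ (Fin n),
      {l ∈ L | e.symm q - l ∈ euclideanProd A (Metric.closedBall 0 1)}.encard = k :=
    (volume_preserving_finAddEquivProd.symm e.toHomeomorph.toMeasurableEquiv).quasiMeasurePreserving.ae hL
  rw [Measure.volume_eq_prod] at h1
  obtain ⟨y, hy⟩ := (Measure.ae_ae_of_ae_prod h1).exists
  -- Indexing by translates rather than by their second components keeps multiplicities.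
  refine not_ae_encard_closedBall_eq hn hk
    (fun l : {l : EuclideanSpace ℝ (Fin (m + n)) // l ∈ L ∧ y - (e l).1 ∈ A} => (e l).2) ?_
  filter_upwards [hy] with z hz
  rw [← hz, ← Subtype.val_injective.encard_image]
  congr 1
  ext l
  simp only [euclideanProd_eq_preimage, mem_image, mem_ofPred_eq, mem_preimage, ← he, map_sub,
    ContinuousLinearEquiv.apply_symm_apply, mem_prod, Prod.fst_sub, Prod.snd_sub,
    mem_closedBall_iff_norm, sub_zero, Subtype.exists, exists_and_right, exists_eq_right]
  tauto

/-! ### Products with a ball are not polytopes -/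

theorem infinite_sphere {n : ℕ} (hn : 2 ≤ n) :
    (Metric.sphere (0 : EuclideanSpace ℝ (Fin n)) 1).Infinite := by
  obtain ⟨u, v, hu, hv, huv⟩ := exists_orthonormal_pair hn
  intro hfin
  -- Each circle point `q` has inner product 1 with itself, so a finite sphere would cover the
  -- parameter line by finitely many finite sets.
  refine infinite_univ ((hfin.biUnion fun q _ =>
    finite_inner_circleParam_eq u v q one_ne_zero).subset fun t _ => ?_)
  have h := norm_circleParam hu hv huv t
  refine mem_biUnion (x := circleParam u v t) (by simpa using h) ?_
  simp [h]

/-- Projecting a polytope to the second factor would make the ball a hull of finitely many points,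
yet every point of its sphere is extreme. -/
theorem not_isPolytope_euclideanProd_closedBall {m n : ℕ} (hn : 2 ≤ n)
    {A : Set (EuclideanSpace ℝ (Fin m))} (hA : A.Nonempty) :
    ¬ IsPolytope (euclideanProd A (Metric.closedBall (0 : EuclideanSpace ℝ (Fin n)) 1)) := by
  rintro ⟨S, hS, hAS⟩
  set e := EuclideanSpace.finAddEquivProd (𝕜 := ℝ) (n := m) (m := n) with he
  let f := (LinearMap.snd ℝ _ _).comp e.toLinearEquiv.toLinearMap
  have h1 : f '' euclideanProd A (Metric.closedBall 0 1) = Metric.closedBall 0 1 := by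
    rw [euclideanProd_eq_preimage]
    ext z
    constructor
    · rintro ⟨x, hx, rfl⟩
      exact hx.2
    · intro hz
      obtain ⟨y, hy⟩ := hA
      exact ⟨e.symm (y, z), by simp [← he, hy, -Metric.mem_closedBall, hz], by simp [f]⟩
  rw [hAS, f.image_convexHull] at h1
  refine infinite_sphere hn ((hS.image f).subset ?_)
  refine (StrictConvexSpace.sphere_subset_extremePoints_closedBall _ one_ne_zero).trans ?_
  rw [← h1]
  exact extremePoints_convexHull_subset

/-! ### Fourier transforms of products -/

theorem inner_eq_inner_finAddEquivProd {m n : ℕ} (x y : EuclideanSpace ℝ (Fin (m + n))) :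
    inner ℝ x y =
      inner ℝ (EuclideanSpace.finAddEquivProd x).1 (EuclideanSpace.finAddEquivProd y).1 +
      inner ℝ (EuclideanSpace.finAddEquivProd x).2 (EuclideanSpace.finAddEquivProd y).2 := by
  simp only [finAddEquivProd_apply, PiLp.inner_apply, Fin.sum_univ_add]

theorem indicatorFourier_euclideanProd {m n : ℕ} (A : Set (EuclideanSpace ℝ (Fin m)))
    (B : Set (EuclideanSpace ℝ (Fin n))) (w : EuclideanSpace ℝ (Fin (m + n))) :
    indicatorFourier (euclideanProd A B) w =
      indicatorFourier A (EuclideanSpace.finAddEquivProd w).1 *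
        indicatorFourier B (EuclideanSpace.finAddEquivProd w).2 := by
  simp only [indicatorFourier, Real.fourier_eq]
  set e := EuclideanSpace.finAddEquivProd (𝕜 := ℝ) (n := m) (m := n)
  rw [← integral_prod_mul, ← Measure.volume_eq_prod,
    ← (volume_preserving_finAddEquivProd (m := m) (n := n)).integral_comp
      e.toHomeomorph.measurableEmbedding]
  congr 1
  ext x
  rw [inner_eq_inner_finAddEquivProd, neg_add, AddChar.map_add_eq_mul, euclideanProd_eq_preimage]
  by_cases h1 : (e x).1 ∈ A <;> by_cases h2 : (e x).2 ∈ B <;>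
    simp_all [indicator, mem_prod, e, Circle.smul_def]

/-! ### Kites and their Fourier transforms -/

/-- The planar region `|x| ≤ 1`, `|y| ≤ b - (b - a) |x|`, with vertices `(0, ± b)`, `(± 1, ± a)`. -/
noncomputable def kite (a b : ℝ) : Set (ℝ × ℝ) := {p | |p.1| ≤ 1 ∧ |p.2| ≤ b - (b - a) * |p.1|}

/-- The pairing of the Euclidean plane with `ℝ × ℝ`. -/
noncomputable def planeEquiv : EuclideanSpace ℝ (Fin 2) ≃ᵐ ℝ × ℝ :=
  (MeasurableEquiv.toLp 2 (Fin 2 → ℝ)).symm.trans MeasurableEquiv.finTwoArrow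

theorem planeEquiv_apply (x : EuclideanSpace ℝ (Fin 2)) : planeEquiv x = (x 0, x 1) := rfl

theorem volume_preserving_planeEquiv : MeasurePreserving planeEquiv :=
  (volume_preserving_finTwoArrow ℝ).comp (PiLp.volume_preserving_ofLp (Fin 2))

theorem isCompact_kite {a b : ℝ} (hab : a ≤ b) : IsCompact (kite a b) := by
  refine Metric.isCompact_of_isClosed_isBounded ?_ ?_
  · have h1 : IsClosed {p : ℝ × ℝ | |p.1| ≤ 1} := isClosed_le (by fun_prop) (by fun_prop)
    have h2 : IsClosed {p : ℝ × ℝ | |p.2| ≤ b - (b - a) * |p.1|} :=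
      isClosed_le (by fun_prop) (by fun_prop)
    exact h1.inter h2
  · refine (Metric.isBounded_Icc ((-1, -b) : ℝ × ℝ) (1, b)).subset fun p hp => ?_
    have h1 := abs_le.1 hp.1
    have h2 := abs_le.1 (hp.2.trans (sub_le_self b (mul_nonneg (sub_nonneg.2 hab) (abs_nonneg _))))
    exact ⟨⟨h1.1, h2.1⟩, ⟨h1.2, h2.2⟩⟩

theorem fourierChar_int (j : ℤ) : Real.fourierChar (j : ℝ) = 1 := by
  ext
  rw [Real.fourierChar_apply, Circle.coe_one, Complex.exp_eq_one_iff]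
  exact ⟨j, by push_cast; ring⟩

/-- The character `x ↦ exp (-2 π i k x)`. -/
noncomputable def expChar (k : ℤ) (x : ℝ) : ℂ := (Real.fourierChar (-(x * k)) : ℂ)

theorem continuous_expChar (k : ℤ) : Continuous (expChar k) := by
  unfold expChar
  fun_prop

theorem periodic_expChar (k j : ℤ) : Function.Periodic (expChar k) (j : ℝ) := by
  intro x
  rw [expChar, expChar, show -((x + j) * (k : ℝ)) = -(x * k) + ((-(j * k) : ℤ) : ℝ) by
    push_cast; ring, AddChar.map_add_eq_mul, fourierChar_int, mul_one]

/-- Shifted by the period 3, `[-q, q]` becomes `[p, 6 - p]`, which abuts `[-p, p]`. The union has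
length 6, a period, so its position is irrelevant. -/
theorem integral_expChar_add_integral_expChar (k : ℤ) {p q : ℝ} (hpq : p + q = 3) :
    (∫ y in -p..p, expChar k y) + ∫ y in -q..q, expChar k y = ∫ y in (0 : ℝ)..6, expChar k y := by
  have hi (s t : ℝ) : IntervalIntegrable (expChar k) volume s t :=
    (continuous_expChar k).intervalIntegrable s t
  have h3 : Function.Periodic (expChar k) 3 := by exact_mod_cast periodic_expChar k 3
  have h6 : Function.Periodic (expChar k) 6 := by exact_mod_cast periodic_expChar k 6
  have h1 : ∫ y in -q..q, expChar k y = ∫ y in p..(-p + 6), expChar k y := by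
    have h := intervalIntegral.integral_comp_add_right (a := -q) (b := q) (expChar k) 3
    simp only [h3 _] at h
    rw [h]
    congr 1 <;> linarith
  rw [h1, intervalIntegral.integral_add_adjacent_intervals (hi _ _) (hi _ _),
    h6.intervalIntegral_add_eq (-p) 0, zero_add]

/-- The right-hand side does not involve `a` and `b` separately; this is what makes the two
transforms agree. -/
theorem integral_kite {a b : ℝ} (ha : 0 ≤ a) (hab : a ≤ b) (h3 : a + b = 3) (k l : ℤ) :
    ∫ p, (kite a b).indicator (fun p => expChar k p.1 * expChar l p.2) p =
      (∫ x in (0 : ℝ)..1, expChar k x) * ∫ y in (0 : ℝ)..6, expChar l y := by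
  have hk := continuous_expChar k
  have hl := continuous_expChar l
  set f : ℝ → ℝ := fun t => b - (b - a) * t with hf
  set J : ℝ → ℂ := fun t => ∫ y in -(f t)..f t, expChar l y with hJ
  have hJc : Continuous J := by
    have hl' : ∀ s t, IntervalIntegrable (expChar l) volume s t := fun s t =>
      hl.intervalIntegrable s t
    have : J = fun t => (∫ y in (0 : ℝ)..f t, expChar l y) - ∫ y in (0 : ℝ)..-(f t), expChar l y := by
      ext t
      rw [intervalIntegral.integral_interval_sub_left (hl' _ _) (hl' _ _)]
    rw [this]
    have hp := intervalIntegral.continuous_primitive hl' 0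
    exact (hp.comp (by fun_prop)).sub (hp.comp (by fun_prop))
  have hint : Integrable ((kite a b).indicator (fun p => expChar k p.1 * expChar l p.2)) := by
    rw [integrable_indicator_iff (isCompact_kite hab).measurableSet]
    exact Continuous.continuousOn (by fun_prop) |>.integrableOn_compact (isCompact_kite hab)
  have hslice : ∀ x : ℝ, ∫ y, (kite a b).indicator (fun p => expChar k p.1 * expChar l p.2) (x, y) =
      (Icc (-1 : ℝ) 1).indicator (fun x => expChar k x * J |x|) x := by
    intro x
    by_cases hx : |x| ≤ 1
    · have hfx : 0 ≤ f |x| := by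
        have := mul_le_mul_of_nonneg_left hx (sub_nonneg.2 hab)
        simp only [hf]; linarith
      have h1 : ∀ y, (kite a b).indicator (fun p => expChar k p.1 * expChar l p.2) (x, y) =
          (Icc (-(f |x|)) (f |x|)).indicator (fun y => expChar k x * expChar l y) y := by
        intro y
        by_cases hy : |y| ≤ f |x|
        · rw [indicator_of_mem (show (x, y) ∈ kite a b from ⟨hx, hy⟩),
            indicator_of_mem (mem_Icc.2 (abs_le.1 hy))]
        · rw [indicator_of_notMem (fun h : (x, y) ∈ kite a b => hy h.2),
            indicator_of_notMem (fun h : y ∈ Icc _ _ => hy (abs_le.2 h))]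
      simp_rw [h1]
      rw [indicator_of_mem (mem_Icc.2 (abs_le.1 hx)), integral_indicator measurableSet_Icc,
        integral_const_mul]
      simp only [hJ]
      rw [intervalIntegral.integral_of_le (by linarith),
        integral_Icc_eq_integral_Ioc]
    · rw [indicator_of_notMem (fun h : x ∈ Icc _ _ => hx (abs_le.2 h))]
      simp_rw [indicator_of_notMem (fun h : (x, _) ∈ kite a b => hx h.1)]
      simp
  rw [Measure.volume_eq_prod] at hint ⊢
  rw [integral_prod _ hint]
  simp_rw [hslice]
  have hcont : Continuous fun x => expChar k x * J |x| := by fun_prop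
  rw [integral_indicator measurableSet_Icc, integral_Icc_eq_integral_Ioc,
    ← intervalIntegral.integral_of_le (by norm_num),
    ← intervalIntegral.integral_add_adjacent_intervals (b := 0)
      (hcont.intervalIntegrable _ _) (hcont.intervalIntegrable _ _)]
  -- Fold `[-1, 0]` onto `[0, 1]`; the first character has period 1, so only the section heights
  -- change.
  have hshift := intervalIntegral.integral_comp_sub_right (a := 0) (b := 1)
    (fun x => expChar k x * J |x|) 1
  rw [zero_sub, sub_self] at hshift
  rw [← hshift, ← intervalIntegral.integral_add
    (Continuous.intervalIntegrable (by fun_prop) _ _) (hcont.intervalIntegrable _ _),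
    ← intervalIntegral.integral_mul_const]
  refine intervalIntegral.integral_congr fun x hx => ?_
  rw [uIcc_of_le zero_le_one] at hx
  have hper : expChar k (x - 1) = expChar k x := by
    have := (periodic_expChar k 1).sub_eq x
    exact_mod_cast this
  simp only [hper]
  rw [abs_of_nonneg hx.1, abs_of_nonpos (by linarith [hx.2]), ← mul_add,
    integral_expChar_add_integral_expChar l (p := f (-(x - 1))) (q := f x)
      (by simp only [hf]; linarith)]

theorem indicatorFourier_preimage_kite {a b : ℝ} (ha : 0 ≤ a) (hab : a ≤ b) (h3 : a + b = 3)
    (k : Fin 2 → ℤ) :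
    indicatorFourier (planeEquiv ⁻¹' kite a b) (WithLp.toLp 2 (fun i => (k i : ℝ))) =
      (∫ x in (0 : ℝ)..1, expChar (k 0) x) * ∫ y in (0 : ℝ)..6, expChar (k 1) y := by
  rw [← integral_kite ha hab h3, ← volume_preserving_planeEquiv.integral_comp',
    indicatorFourier, Real.fourier_eq]
  congr 1
  ext x
  by_cases hx : planeEquiv x ∈ kite a b
  · rw [indicator_of_mem hx, indicator_of_mem (mem_preimage.2 hx), Circle.smul_def, smul_eq_mul,
      mul_one, PiLp.inner_apply, Fin.sum_univ_two, neg_add, AddChar.map_add_eq_mul]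
    simp [expChar, planeEquiv_apply, mul_comm]
  · rw [indicator_of_notMem hx, indicator_of_notMem (by exact hx), smul_zero]

/-! ### The rhombus and the hexagon as kites -/

theorem convex_kite {a b : ℝ} (hab : a ≤ b) : Convex ℝ (kite a b) := by
  have h : kite a b = {p | |p.1| ≤ 1} ∩ {p | |p.2| + (b - a) * |p.1| ≤ b} := by
    ext p
    simp only [kite, mem_ofPred_eq, mem_inter_iff, le_sub_iff_add_le]
  have h1 : ConvexOn ℝ univ fun p : ℝ × ℝ => |p.1| :=
    convexOn_univ_norm.comp_linearMap (LinearMap.fst ℝ ℝ ℝ)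
  have h2 : ConvexOn ℝ univ fun p : ℝ × ℝ => |p.2| :=
    convexOn_univ_norm.comp_linearMap (LinearMap.snd ℝ ℝ ℝ)
  have h3 := h2.add (h1.smul (sub_nonneg.2 hab))
  rw [h]
  simpa using (h1.convex_le 1).inter (h3.convex_le b)

theorem one_sub_smul_add_smul_mem {E : Type*} [AddCommGroup E] [Module ℝ E] {C : Set E}
    (hC : Convex ℝ C) {p q : E} (hp : p ∈ C) (hq : q ∈ C) {t : ℝ} (h0 : 0 ≤ t) (h1 : t ≤ 1) :
    (1 - t) • p + t • q ∈ C :=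
  hC hp hq (sub_nonneg.2 h1) h0 (by ring)

/-- Every point lies on a vertical segment whose ends lie on edges joining the listed vertices. -/
theorem preimage_kite_subset {a b : ℝ} {C : Set (EuclideanSpace ℝ (Fin 2))} (hC : Convex ℝ C)
    (h1 : !₂[-1, a] ∈ C) (h2 : !₂[-1, -a] ∈ C) (h3 : !₂[0, b] ∈ C) (h4 : !₂[0, -b] ∈ C)
    (h5 : !₂[1, a] ∈ C) (h6 : !₂[1, -a] ∈ C) : planeEquiv ⁻¹' kite a b ⊆ C := by
  intro z hz
  obtain ⟨hx, hy⟩ := hz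
  simp only [planeEquiv_apply] at hx hy
  set f := b - (b - a) * |z 0| with hf
  have hends : !₂[z 0, f] ∈ C ∧ !₂[z 0, -f] ∈ C := by
    rcases le_total 0 (z 0) with h | h
    · rw [abs_of_nonneg h] at hx hf
      constructor
      · convert one_sub_smul_add_smul_mem hC h3 h5 h hx using 1
        ext i; fin_cases i <;> simp [hf]; ring
      · convert one_sub_smul_add_smul_mem hC h4 h6 h hx using 1
        ext i; fin_cases i <;> simp [hf]; ring
    · rw [abs_of_nonpos h] at hx hf
      constructor
      · convert one_sub_smul_add_smul_mem hC h3 h1 (neg_nonneg.2 h) hx using 1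
        ext i; fin_cases i <;> simp [hf]; ring
      · convert one_sub_smul_add_smul_mem hC h4 h2 (neg_nonneg.2 h) hx using 1
        ext i; fin_cases i <;> simp [hf]; ring
  have hy' := abs_le.1 hy
  -- The segment degenerates when `f = 0`, as at the side tips of the rhombus.
  rcases (abs_nonneg _ |>.trans hy).eq_or_lt with h0 | h0
  · have : z = !₂[z 0, f] := by
      ext i; fin_cases i <;> simp; linarith
    rw [this]; exact hends.1
  · convert one_sub_smul_add_smul_mem hC hends.2 hends.1 (t := (z 1 + f) / (2 * f))
      (div_nonneg (by linarith) (by linarith)) ((div_le_one (by linarith)).2 (by linarith)) using 1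
    ext i; fin_cases i <;> simp
    · ring
    · field_simp; ring

theorem convex_preimage_kite {a b : ℝ} (hab : a ≤ b) : Convex ℝ (planeEquiv ⁻¹' kite a b) :=
  (convex_kite hab).is_linear_preimage (f := planeEquiv)
    ⟨fun _ _ => rfl, fun _ _ => rfl⟩

theorem rhombus_eq : rhombus = planeEquiv ⁻¹' kite 0 3 := by
  refine (convexHull_min ?_ (convex_preimage_kite (by norm_num))).antisymm
    (preimage_kite_subset (convex_convexHull ℝ _) ?_ ?_ ?_ ?_ ?_ ?_)
  · rintro x (rfl | rfl | rfl | rfl) <;> norm_num [kite, planeEquiv_apply]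
  all_goals exact subset_convexHull ℝ _ (by simp)

theorem hexagon_eq : hexagon = planeEquiv ⁻¹' kite 1 2 := by
  refine (convexHull_min ?_ (convex_preimage_kite (by norm_num))).antisymm
    (preimage_kite_subset (convex_convexHull ℝ _) ?_ ?_ ?_ ?_ ?_ ?_)
  · rintro x (rfl | rfl | rfl | rfl | rfl | rfl) <;> norm_num [kite, planeEquiv_apply]
  all_goals exact subset_convexHull ℝ _ (by simp)

theorem nonempty_interior_preimage_kite (a : ℝ) {b : ℝ} (hb : 0 < b) :
    (interior (planeEquiv ⁻¹' kite a b)).Nonempty := by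
  have h1 : IsOpen {x : EuclideanSpace ℝ (Fin 2) | |x 0| < 1} :=
    isOpen_lt (by fun_prop) (by fun_prop)
  have h2 : IsOpen {x : EuclideanSpace ℝ (Fin 2) | |x 1| < b - (b - a) * |x 0|} :=
    isOpen_lt (by fun_prop) (by fun_prop)
  refine ⟨0, mem_interior.2 ⟨_, ?_, h1.inter h2, by simpa using hb⟩⟩
  exact fun x hx => ⟨le_of_lt hx.1, le_of_lt hx.2⟩

theorem isConvexBody_rhombus : IsConvexBody rhombus :=
  ⟨convex_convexHull ℝ _, (toFinite _).isCompact_convexHull ℝ,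
    rhombus_eq ▸ nonempty_interior_preimage_kite _ (by norm_num)⟩

theorem isConvexBody_hexagon : IsConvexBody hexagon :=
  ⟨convex_convexHull ℝ _, (toFinite _).isCompact_convexHull ℝ,
    hexagon_eq ▸ nonempty_interior_preimage_kite _ (by norm_num)⟩

theorem isCentrallySymmetric_preimage_kite (a b : ℝ) :
    IsCentrallySymmetric (planeEquiv ⁻¹' kite a b) := by
  intro x hx
  simpa [kite, planeEquiv_apply] using hx

theorem fourierAgreeOnLattice_timesBall (n : ℕ) :
    FourierAgreeOnLattice (timesBall rhombus n) (timesBall hexagon n) := by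
  intro k
  simp only [timesBall, indicatorFourier_euclideanProd, finAddEquivProd_apply]
  congr 1
  rw [rhombus_eq, hexagon_eq, indicatorFourier_preimage_kite (by norm_num) (by norm_num)
    (by norm_num) (fun i => k (Fin.castAdd n i)), indicatorFourier_preimage_kite (by norm_num)
    (by norm_num) (by norm_num) (fun i => k (Fin.castAdd n i))]

/-! ### Non-congruence -/

/-- The part of `g '' interior A` outside the closed set `B` is open and null, hence empty; taking
closures extends the inclusion to `A`. -/
theorem image_subset_of_image_ae_eq {d : ℕ} {A B : Set (EuclideanSpace ℝ (Fin d))}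
    (hA : A ⊆ closure (interior A)) (hB : IsClosed B)
    (g : EuclideanSpace ℝ (Fin d) ≃ᵃⁱ[ℝ] EuclideanSpace ℝ (Fin d))
    (h : g '' A =ᵐ[(volume : Measure (EuclideanSpace ℝ (Fin d)))] B) : g '' A ⊆ B := by
  have hint : g '' interior A ⊆ B := by
    have hopen : IsOpen (g '' interior A \ B) :=
      (g.toHomeomorph.isOpenMap _ isOpen_interior).sdiff hB
    refine sdiff_eq_empty.1 (hopen.eq_empty_of_measure_zero (μ := volume) ?_)
    exact measure_mono_null (sdiff_subset_sdiff_left (image_mono interior_subset))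
      (ae_le_set.1 h.le)
  calc g '' A ⊆ g '' closure (interior A) := image_mono hA
    _ ⊆ closure (g '' interior A) := image_closure_subset_closure_image g.continuous
    _ ⊆ B := closure_minimal hint hB

theorem norm_sq_eq_finAddEquivProd {m n : ℕ} (x : EuclideanSpace ℝ (Fin (m + n))) :
    ‖x‖ ^ 2 = ‖(EuclideanSpace.finAddEquivProd x).1‖ ^ 2 +
      ‖(EuclideanSpace.finAddEquivProd x).2‖ ^ 2 := by
  simp only [← real_inner_self_eq_norm_sq, inner_eq_inner_finAddEquivProd x x]

theorem norm_sq_le_of_mem_timesBall_hexagon {n : ℕ} {x : EuclideanSpace ℝ (Fin (2 + n))}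
    (hx : x ∈ timesBall hexagon n) : ‖x‖ ^ 2 ≤ 5 := by
  rw [timesBall, euclideanProd_eq_preimage, hexagon_eq] at hx
  obtain ⟨⟨h0, h1⟩, h2⟩ := hx
  rw [norm_sq_eq_finAddEquivProd]
  set y := EuclideanSpace.finAddEquivProd x
  simp only [planeEquiv_apply] at h0 h1
  rw [mem_closedBall_zero_iff] at h2
  rw [EuclideanSpace.norm_sq_eq, Fin.sum_univ_two, Real.norm_eq_abs, Real.norm_eq_abs]
  have := abs_nonneg (y.1 0)
  have := abs_nonneg (y.1 1)
  have := norm_nonneg y.2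
  nlinarith

theorem not_coincideUpToRigidMotion_timesBall (n : ℕ) :
    ¬ CoincideUpToRigidMotion (timesBall rhombus n) (timesBall hexagon n) := by
  rintro ⟨g, hg⟩
  have hP : IsConvexBody (timesBall rhombus n) :=
    isConvexBody_euclideanProd isConvexBody_rhombus (isConvexBody_closedBall n)
  have hQ := isConvexBody_euclideanProd isConvexBody_hexagon (isConvexBody_closedBall n)
  have hsub := image_subset_of_image_ae_eq
    (by rw [hP.1.closure_interior_eq_closure_of_nonempty_interior hP.2.2]; exact subset_closure)
    hQ.2.1.isClosed g hg
  let p : EuclideanSpace ℝ (Fin (2 + n)) := EuclideanSpace.finAddEquivProd.symm (!₂[0, 3], 0)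
  have hep : EuclideanSpace.finAddEquivProd p = ((!₂[0, 3], 0) : _ × _) :=
    ContinuousLinearEquiv.apply_symm_apply _ _
  have hpP : p ∈ timesBall rhombus n := by
    rw [timesBall, euclideanProd_eq_preimage, mem_preimage, hep, rhombus_eq]
    refine ⟨?_, by simp⟩
    norm_num [kite, planeEquiv_apply]
  have hpP' : -p ∈ timesBall rhombus n :=
    isCentrallySymmetric_euclideanProd (rhombus_eq ▸ isCentrallySymmetric_preimage_kite 0 3)
      (isCentrallySymmetric_closedBall n) p hpP
  have hnorm : ‖p‖ ^ 2 = 9 := by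
    rw [norm_sq_eq_finAddEquivProd, hep]
    norm_num [EuclideanSpace.norm_sq_eq]
  have h1 := norm_sq_le_of_mem_timesBall_hexagon (hsub ⟨p, hpP, rfl⟩)
  have h2 := norm_sq_le_of_mem_timesBall_hexagon (hsub ⟨-p, hpP', rfl⟩)
  have hdist : ‖g p - g (-p)‖ = 2 * ‖p‖ := by
    rw [← dist_eq_norm, g.dist_map, dist_eq_norm, sub_neg_eq_add, ← two_smul ℝ p, norm_smul]
    norm_num
  -- The images of `±p` are at distance 6 but have squared norms at most 5, so the law would give
  -- `36 ≤ 20`.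
  have h3 := parallelogram_law_with_norm ℝ (g p) (g (-p))
  rw [hdist] at h3
  nlinarith [sq_nonneg ‖g p + g (-p)‖]

theorem isRobinsCounterexample_timesBall {n : ℕ} (hn : 2 ≤ n) :
    IsRobinsCounterexample (timesBall rhombus n) (timesBall hexagon n) :=
  ⟨⟨isConvexBody_euclideanProd isConvexBody_rhombus (isConvexBody_closedBall n),
      isConvexBody_euclideanProd isConvexBody_hexagon (isConvexBody_closedBall n)⟩,
    ⟨isCentrallySymmetric_euclideanProd (rhombus_eq ▸ isCentrallySymmetric_preimage_kite 0 3)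
        (isCentrallySymmetric_closedBall n),
      isCentrallySymmetric_euclideanProd (hexagon_eq ▸ isCentrallySymmetric_preimage_kite 1 2)
        (isCentrallySymmetric_closedBall n)⟩,
    ⟨not_isMultiTiler_euclideanProd_closedBall hn _,
      not_isMultiTiler_euclideanProd_closedBall hn _⟩,
    fourierAgreeOnLattice_timesBall n, not_coincideUpToRigidMotion_timesBall n⟩

theorem theorem1 :
    (∀ d : ℕ, 4 ≤ d → ¬ RobinsConjecture d) ∧
    (∀ n : ℕ, 4 ≤ 2 + n →
      IsRobinsCounterexample (timesBall rhombus n) (timesBall hexagon n) ∧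
      ¬ IsPolytope (timesBall rhombus n) ∧ ¬ IsPolytope (timesBall hexagon n)) := by
  refine ⟨fun d hd hconj => ?_, fun n hn => ?_⟩
  · obtain ⟨n, rfl⟩ := Nat.exists_eq_add_of_le (show 2 ≤ d by omega)
    obtain ⟨⟨hP, hQ⟩, ⟨hPs, hQs⟩, ⟨hPt, hQt⟩, hF, hc⟩ :=
      isRobinsCounterexample_timesBall (show 2 ≤ n by omega)
    exact hc ((hconj _ _ hP hQ hPs hQs hPt hQt).1 hF)
  · have hn' : 2 ≤ n := by omega
    exact ⟨isRobinsCounterexample_timesBall hn',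
      not_isPolytope_euclideanProd_closedBall hn'
        (isConvexBody_rhombus.2.2.mono interior_subset),
      not_isPolytope_euclideanProd_closedBall hn'
        (isConvexBody_hexagon.2.2.mono interior_subset)⟩
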